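/- **Setting.** Let $(M,\mathbf T)$ be a triangulated oriented closed pseudo 3-manifold: the quotient of a finite disjoint union of oriented tetrahedra whose 2-faces are identified in pairs by orientation-reversing affine homeomorphisms. Let $V,E,T$ be its sets of vertices, edges and tetrahedra (vertices and edges being equivalence classes, under the identifications, of vertices and edges of the individual tetrahedra). Let $\triangle$ and $\Box$ be the sets of normal isotopy classes of normal triangles (four in each tetrahedron, one for each of its vertices) and normal quadrilaterals (three in each tetrahedron, one for each pair of opposite edges). For $q\in\Box$ and $e\in E$, let $i(q,e)\in\{0,1,2\}$ be the number of edges of the tetrahedron containing $q$ that represent $e$ and are disjoint from $q$. For $q,q'\in\Box$ in the same tetrahedron, $\omega(q,q')=1$ if $q'$ follows $q$ in the cyclic order of the three quadrilaterals induced by the orientation of the tetrahedron (the cyclic order, viewed from a vertex, of the three edges at this vertex, each edge standing for the quadrilateral disjoint from it). Let $k:E\to\mathbf S^1$ satisfy $$\prod_{e\in E}k(e)=1\quad(2.16),\qquad \prod_{e>v}k(e)=1\ \text{ for every } v\in V\quad(2.17),$$ where in (2.17) there is one factor for each end of an edge at $v$ (so an edge that is a loop at $v$ contributes $k(e)^2$).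 Let $SAS(\mathbf T,k)$ be the set of $x:\Box\to\mathbf S^1$ with $$\prod_{q\subset\sigma}x(q)=-1\ \ (\sigma\in T),\qquad \prod_{q\in\Box}x(q)^{i(q,e)}=k(e)\ \ (e\in E),$$ and for such $x$ let $\mathbf V(x)=\sum_{q\in\Box}\Lambda(\arg x(q))$, where $\Lambda(a)=-\int_0^a\ln|2\sin u|\,du$. **Theorem 3.2.** Let $p$ be a maximum point of $\mathbf V: SAS(\mathbf T,k)\to\mathbf R$. (a) If $p$ is a smooth point, i.e. $p(q)\neq\pm1$ for all $q\in\Box$, then $p$ produces a solution of the generalized Thurston gluing equations: there is $z\in\mathbf C^{\Box}$ such that $z(q)$ is a real multiple of $p(q)$ for every $q\in\Box$, and $$z(q')(1-z(q))=1\ \text{ whenever } \omega(q,q')=1\quad(3.3),\qquad \prod_{q\in\Box}z(q)^{2i(q,e)}=k(e)^2\ \text{ for every } e\in E\quad(3.5).$$ (b) If $p(q_0)=\pm1$ for some $q_0\in\Box$, then there is a solution $(t,y)\in\mathbf R^{\triangle}\times\mathbf R^{\Box}$ of Haken's normal surface equations with $y(q_0)\neq0$ and at most two nonzero quadrilateral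 coordinates $y(q)$. Here Haken's equations require, for each normal arc $a$ in a common face of two tetrahedra $\sigma,\sigma'$ (the two sides of the face), that $t(\tau)+y(q)=t(\tau')+y(q')$, where $\tau,q$ are the normal triangle and quadrilateral in $\sigma$, and $\tau',q'$ those in $\sigma'$, that have $a$ as an edge. Theorem 1.1 is the special case $k\equiv1$. -/

import Mathlib

open scoped BigOperators

noncomputable section

namespace PseudoManifold

/-- A (face-pairing) triangulation of a closed pseudo 3-manifold, with set of tetrahedra `T`.
The vertices of every tetrahedron are labelled by `Fin 4`, and face `i` of a tetrahedron is the
face opposite to its vertex `i`.  Face `i` of `σ` is glued to face `gluePerm σ i i` of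
`glueTet σ i` by the affine homeomorphism which on the vertices `v ≠ i` is the restriction of
the permutation `gluePerm σ i`.  Faces are identified in pairs: the gluing of the partner face is
the inverse one, and no face is its own partner. -/
structure Triangulation (T : Type*) where
  glueTet : T → Fin 4 → T
  gluePerm : T → Fin 4 → Equiv.Perm (Fin 4)
  glueTet_glueTet : ∀ σ i, glueTet (glueTet σ i) (gluePerm σ i i) = σ
  gluePerm_gluePerm : ∀ σ i,
    gluePerm (glueTet σ i) (gluePerm σ i i) = (gluePerm σ i)⁻¹
  glue_ne_self : ∀ σ i, (glueTet σ i, gluePerm σ i i) ≠ (σ, i)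

/-- An oriented triangulated closed pseudo 3-manifold: every tetrahedron carries an orientation,
recorded by its sign relative to the labelling of its vertices by `0, 1, 2, 3`, and all face
gluings reverse the orientations induced on the faces. -/
structure OrientedTriangulation (T : Type*) extends Triangulation T where
  orient : T → ℤˣ
  orient_glue : ∀ σ i,
    orient (glueTet σ i) * Equiv.Perm.sign (gluePerm σ i) = -orient σ

/-- The edges of a single tetrahedron, as two-element sets of vertices. -/
abbrev TetEdge := {s : Finset (Fin 4) // s.card = 2}

/-- The image of an edge of a tetrahedron under a bijection of vertices. -/
def TetEdge.map (g : Equiv.Perm (Fin 4)) (s : TetEdge) : TetEdge :=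
  ⟨s.1.map g.toEmbedding, by rw [Finset.card_map]; exact s.2⟩

/-- Normal isotopy classes of normal triangles: `(σ, v)` is the triangle in the tetrahedron `σ`
cutting off the vertex `v`. -/
abbrev Tri (T : Type*) := T × Fin 4

/-- Normal isotopy classes of normal quadrilaterals: `(σ, j)` is the quadrilateral in the
tetrahedron `σ` which separates the edge `{0, j + 1}` from the opposite edge. -/
abbrev Quad (T : Type*) := T × Fin 3

/-- The quadrilateral of type `j` splits the four vertices of its tetrahedron into two pairs (the
end points of the edge `{0, j + 1}` and those of the opposite edge).  `partner j v` is the other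
vertex in the pair of `v`. -/
def partner : Fin 3 → Equiv.Perm (Fin 4)
  | 0 => Equiv.swap 0 1 * Equiv.swap 2 3
  | 1 => Equiv.swap 0 2 * Equiv.swap 1 3
  | 2 => Equiv.swap 0 3 * Equiv.swap 1 2

/-- The quadrilateral of type `j` is disjoint from the edge `s` of the same tetrahedron, i.e.
both end points of `s` lie on the same side of the quadrilateral. -/
def QuadDisjoint (j : Fin 3) (s : TetEdge) : Prop := ∀ v ∈ s.1, partner j v ∈ s.1

namespace Triangulation

variable {T : Type*} (M : Triangulation T)

/-- The vertex `x` of a tetrahedron is identified with `y` by the gluing of one face. -/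
def VertexGlue (x y : T × Fin 4) : Prop :=
  ∃ i, x.2 ≠ i ∧ y = (M.glueTet x.1 i, M.gluePerm x.1 i x.2)

/-- The edge `x` of a tetrahedron is identified with `y` by the gluing of one face. -/
def EdgeGlue (x y : T × TetEdge) : Prop :=
  ∃ i, i ∉ x.2.1 ∧ y = (M.glueTet x.1 i, x.2.map (M.gluePerm x.1 i))

/-- The vertices of the triangulation: vertices of the tetrahedra modulo the equivalence relation
generated by the face gluings. -/
def Vertex := Quot M.VertexGlue

/-- The edges of the triangulation: edges of the tetrahedra modulo the equivalence relation
generated by the face gluings. -/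
def Edge := Quot M.EdgeGlue

instance [Fintype T] : Fintype M.Vertex :=
  @Fintype.ofFinite _ (inferInstanceAs (Finite (Quot M.VertexGlue)))

instance [Fintype T] : Fintype M.Edge :=
  @Fintype.ofFinite _ (inferInstanceAs (Finite (Quot M.EdgeGlue)))

def mkVertex (σ : T) (v : Fin 4) : M.Vertex := Quot.mk _ (σ, v)

def mkEdge (σ : T) (s : TetEdge) : M.Edge := Quot.mk _ (σ, s)

open Classical in
/-- The number (0, 1 or 2) of ends of the edge `e` at the vertex `v` of the triangulation: an edge
which is a loop at `v` has two ends there. -/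
def numEnds (e : M.Edge) (v : M.Vertex) : ℕ :=
  Quot.lift (fun x : T × TetEdge => (x.2.1.filter fun a => M.mkVertex x.1 a = v).card)
    (by
      rintro ⟨σ, s⟩ y ⟨i, hi, rfl⟩
      simp only [TetEdge.map, Finset.filter_map, Finset.card_map]
      congr 1
      refine Finset.filter_congr fun a ha => ?_
      have h : M.mkVertex σ a = M.mkVertex (M.glueTet σ i) (M.gluePerm σ i a) :=
        Quot.sound ⟨i, fun h => hi (by rw [← h]; exact ha), rfl⟩
      simp [h]) e

open Classical in
/-- The index `i(q, e)`: the number of edges of the tetrahedron containing `q` which represent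
`e` and are disjoint from `q`. -/
def index (q : Quad T) (e : M.Edge) : ℕ :=
  (Finset.univ.filter fun s : TetEdge => M.mkEdge q.1 s = e ∧ QuadDisjoint q.2 s).card

/-- Haken's normal surface equations for triangle coordinates `t` and quadrilateral coordinates
`y`.  In the face `i` of a tetrahedron `σ` there are three normal arcs, one around each vertex
`v ≠ i` of the face.  This arc is an edge of the normal triangle at `v`, and of exactly that
quadrilateral in `σ` which separates `v` from the other two vertices of the face (i.e. pairs `v`
with `i`).  The sums of the two coordinates on both sides of the face agree. -/
def IsNormalSolution (t : Tri T → ℝ) (y : Quad T → ℝ) : Prop :=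
  ∀ (σ : T) (i v : Fin 4), v ≠ i → ∀ j j' : Fin 3,
    partner j v = i → partner j' (M.gluePerm σ i v) = M.gluePerm σ i i →
      t (σ, v) + y (σ, j) =
        t (M.glueTet σ i, M.gluePerm σ i v) + y (M.glueTet σ i, j')

variable [Fintype T]

/-- The two conditions on a curvature `k`: the product of `k` over all edges is `1`, and for each
vertex `v` the product of `k` over all ends of edges at `v` is `1`. -/
def IsAdmissible (k : M.Edge → Circle) : Prop :=
  (∏ e, k e = 1) ∧ ∀ v : M.Vertex, ∏ e, k e ^ M.numEnds e v = 1

/-- The space of circle-valued angle structures with curvature `k`. -/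
def SAS (k : M.Edge → Circle) : Set (Quad T → Circle) :=
  {x | (∀ σ : T, ∏ j : Fin 3, x (σ, j) = -1) ∧
    ∀ e : M.Edge, ∏ q : Quad T, x q ^ M.index q e = k e}

end Triangulation

/-- The Lobachevsky function `Λ(x) = - ∫₀ˣ log |2 sin u| du`. -/
def lobachevsky (x : ℝ) : ℝ := -∫ u in (0 : ℝ)..x, Real.log |2 * Real.sin u|

/-- The volume of a circle-valued angle structure: the sum of `Λ(arg x(q))` over all
quadrilaterals `q`.  Since `Λ` has period `π`, the choice of the argument is irrelevant. -/
def volume {T : Type*} [Fintype T] (x : Quad T → Circle) : ℝ :=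
  ∑ q, lobachevsky (Complex.arg (x q : ℂ))

namespace OrientedTriangulation

variable {T : Type*} (M : OrientedTriangulation T)

open Classical in
/-- The Neumann-Zagier form on pairs of quadrilaterals.  In a tetrahedron of orientation sign `1`
the cyclic order of the edges `{0, 1}`, `{0, 2}`, `{0, 3}` at the vertex `0` induces the cyclic
order `0 → 1 → 2 → 0` on the three quadrilaterals, and the opposite one if the sign is `-1`.  Then
`ω q q' = 1` if `q'` follows `q`, `ω q q' = -1` if `q` follows `q'`, and `ω q q' = 0` if `q = q'`
or if the quadrilaterals lie in different tetrahedra. -/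
def omega (q q' : Quad T) : ℤ :=
  if q.1 = q'.1 then
    if q'.2 = q.2 + 1 then (M.orient q.1 : ℤ)
    else if q.2 = q'.2 + 1 then -(M.orient q.1 : ℤ)
    else 0
  else 0

/-- Solutions of the generalized Thurston gluing equations with curvature `k`. -/
def IsThurstonSolution [Fintype T] (k : M.Edge → Circle) (z : Quad T → ℂ) : Prop :=
  (∀ q q' : Quad T, M.omega q q' = 1 → z q' * (1 - z q) = 1) ∧
    ∀ e : M.Edge, ∏ q : Quad T, z q ^ (2 * M.index q e) = (k e : ℂ) ^ 2

end OrientedTriangulation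

end PseudoManifold

end

/-! The proof moves the maximum point `p` along the curves `t ↦ p(q) exp(i t x(q))`, which stay in
the space of circle-valued angle structures when `x` is a tangential angle structure, i.e. when the
sums of `x` over the tetrahedra and its sums around the edges vanish (`TAS`). Since
`Λ'(u) = -log |2 sin u|`, and since `Λ` behaves near the multiples of `π` like `-u log |u|`, the
volume along such a curve is
`V(p) - A(x) t log |t| - B(x) t + o(t)`, where `A(x)` is the sum of `x(q)` over the set `U` of
quadrilaterals with `p(q) = ±1`, and
`B(x) = ∑_{q ∈ U} x(q) log |x(q)| + ∑_q c(q) x(q)`, with `c(q) = log |2 sin arg p(q)|` off `U`.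
At a maximum, `A(x)` and then `B(x)` vanish for all `x` (`exists_first_variation`).

If `U` is empty, `B` is linear, and it vanishes in particular at `x(r) = ∑_q i(q, e) ω(q, r)`, which
is a tangential angle structure because the edges are isotropic for the Neumann-Zagier form
(`sum_index_mul_omega_mul_index`). This says that the moduli of the shapes
`z(q) = (sin b / sin c) exp(i a)` of triangles with angles `a`, `b`, `c` have product `1` around
`e`. Thurston's equation in a tetrahedron is a trigonometric identity.

If `q₀ ∈ U`, the function `∑_{q ∈ U} x(q) log |x(q)|` is linear on the tangential angle structures.
Its term at `q₀` is not differentiable where `x(q₀)` vanishes, so `x(q₀)` is zero on all of `TAS`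
or proportional there to another `x(q₁)` (`exists_relation_of_sum_mul_log_eq_zero`). The resulting
relation is a function `y` with at most two nonzero values that is orthogonal to `TAS`, hence a
combination of the functions defining `TAS`, those of the tetrahedra and of the edges; all of these
are quadrilateral coordinates of solutions of Haken's equations
(`isNormalSolution_of_tet_edge`). -/

noncomputable section

namespace PseudoManifold

/-! ### Asymptotics of the Lobachevsky function -/

section

open Filter Topology

lemma intervalIntegrable_log_abs_two_mul_sin (a b : ℝ) :
    IntervalIntegrable (fun u => Real.log |2 * Real.sin u|) MeasureTheory.volume a b := by
  have h : MeromorphicOn (fun u : ℝ => 2 * Real.sin u) (Set.uIcc a b) := fun x _ =>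
    (analyticAt_const.mul Real.analyticAt_sin).meromorphicAt
  simpa only [Real.norm_eq_abs] using h.intervalIntegrable_log_norm

lemma integral_log_abs_two_mul_sin_zero_pi :
    ∫ u in (0 : ℝ)..Real.pi, Real.log |2 * Real.sin u| = 0 := by
  have h : ∫ u in (0 : ℝ)..Real.pi, Real.log |2 * Real.sin u| =
      ∫ u in (0 : ℝ)..Real.pi, (Real.log 2 + Real.log (Real.sin u)) := by
    rw [intervalIntegral.integral_of_le Real.pi_pos.le,
      intervalIntegral.integral_of_le Real.pi_pos.le, MeasureTheory.integral_Ioc_eq_integral_Ioo,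
      MeasureTheory.integral_Ioc_eq_integral_Ioo]
    refine MeasureTheory.setIntegral_congr_fun measurableSet_Ioo fun u hu => ?_
    have := (Real.sin_pos_of_mem_Ioo hu).ne'
    simp only [Real.log_abs]
    rw [Real.log_mul two_ne_zero this]
  have hint : IntervalIntegrable (fun u => Real.log (Real.sin u)) MeasureTheory.volume 0
      Real.pi := intervalIntegrable_log_sin
  rw [h, intervalIntegral.integral_add intervalIntegrable_const hint, integral_log_sin_zero_pi]
  simp
  ring

lemma lobachevsky_add_pi (u : ℝ) : lobachevsky (u + Real.pi) = lobachevsky u := by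
  have hper : Function.Periodic (fun u => Real.log |2 * Real.sin u|) Real.pi := fun u => by
    simp [Real.sin_add_pi]
  have := hper.intervalIntegral_add_eq_add 0 u fun a b =>
    intervalIntegrable_log_abs_two_mul_sin a b
  rw [zero_add, integral_log_abs_two_mul_sin_zero_pi, add_zero] at this
  rw [lobachevsky, lobachevsky, this]

lemma lobachevsky_periodic : Function.Periodic lobachevsky Real.pi := lobachevsky_add_pi

lemma continuous_lobachevsky : Continuous lobachevsky :=
  (intervalIntegral.continuous_primitive intervalIntegrable_log_abs_two_mul_sin 0).neg

lemma hasDerivAt_lobachevsky {u : ℝ} (hu : Real.sin u ≠ 0) :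
    HasDerivAt lobachevsky (-Real.log |2 * Real.sin u|) u := by
  refine (intervalIntegral.integral_hasDerivAt_right
    (intervalIntegrable_log_abs_two_mul_sin 0 u) ?_ ?_).neg
  · exact Measurable.stronglyMeasurable (by fun_prop) |>.stronglyMeasurableAtFilter
  · refine ContinuousAt.log (by fun_prop) ?_
    simpa using hu

/-- The singularity of the Lobachevsky function at `0` is that of `-u log u`. -/
lemma hasDerivAt_lobachevsky_add_mul_log :
    HasDerivAt (fun u => lobachevsky u + u * Real.log u) (1 - Real.log 2) 0 := by
  -- The derivative away from `0`, extended continuously by means of `sinc u = sin u / u`.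
  set g : ℝ → ℝ := fun u => 1 - Real.log (2 * Real.sinc u) with hg
  have hg0 : g 0 = 1 - Real.log 2 := by simp [hg]
  have hgc : Tendsto g (𝓝 0) (𝓝 (1 - Real.log 2)) := by
    rw [← hg0]
    have : ContinuousAt g 0 := by
      refine continuousAt_const.sub (ContinuousAt.log ?_ (by simp))
      exact continuousAt_const.mul Real.continuous_sinc.continuousAt
    exact this
  have hder : ∀ u, u ≠ 0 → u ∈ Set.Ioo (-Real.pi) Real.pi →
      HasDerivAt (fun u => lobachevsky u + u * Real.log u) (g u) u := by
    intro u hu0 hu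
    have hsin : Real.sin u ≠ 0 := fun h => hu0 ((Real.sin_eq_zero_iff_of_lt_of_lt hu.1 hu.2).1 h)
    refine ((hasDerivAt_lobachevsky hsin).add (Real.hasDerivAt_mul_log hu0)).congr_deriv ?_
    simp only [hg, Real.log_abs, Real.sinc_of_ne_zero hu0]
    rw [Real.log_mul two_ne_zero (div_ne_zero hsin hu0), Real.log_div hsin hu0,
      Real.log_mul two_ne_zero hsin]
    ring
  have hcont : Continuous fun u => lobachevsky u + u * Real.log u :=
    continuous_lobachevsky.add Real.continuous_mul_log
  have hr : HasDerivWithinAt (fun u => lobachevsky u + u * Real.log u) (1 - Real.log 2)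
      (Set.Ici 0) 0 := by
    have hd : ∀ u ∈ Set.Ioo 0 Real.pi, HasDerivAt _ _ u := fun u hu =>
      hder u hu.1.ne' ⟨by linarith [hu.1, Real.pi_pos], hu.2⟩
    refine hasDerivWithinAt_Ici_of_tendsto_deriv (s := Set.Ioo 0 Real.pi)
      (fun u hu => (hd u hu).differentiableAt.differentiableWithinAt)
      hcont.continuousWithinAt (Ioo_mem_nhdsGT Real.pi_pos) ?_
    refine (hgc.mono_left nhdsWithin_le_nhds).congr' ?_
    filter_upwards [Ioo_mem_nhdsGT Real.pi_pos] with u hu using (hd u hu).deriv.symm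
  have hl : HasDerivWithinAt (fun u => lobachevsky u + u * Real.log u) (1 - Real.log 2)
      (Set.Iic 0) 0 := by
    have hpi : -Real.pi < 0 := by linarith [Real.pi_pos]
    have hd : ∀ u ∈ Set.Ioo (-Real.pi) 0, HasDerivAt _ _ u := fun u hu =>
      hder u hu.2.ne ⟨hu.1, by linarith [hu.2, Real.pi_pos]⟩
    refine hasDerivWithinAt_Iic_of_tendsto_deriv (s := Set.Ioo (-Real.pi) 0)
      (fun u hu => (hd u hu).differentiableAt.differentiableWithinAt)
      hcont.continuousWithinAt (Ioo_mem_nhdsLT hpi) ?_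
    refine (hgc.mono_left nhdsWithin_le_nhds).congr' ?_
    filter_upwards [Ioo_mem_nhdsLT hpi] with u hu using (hd u hu).deriv.symm
  simpa [Set.Iic_union_Ici, hasDerivWithinAt_univ] using hl.union hr

/-- A function of the form `h(t) - a t log t` with `h` differentiable at `0` can have a maximum
at `0` only if both of its leading terms vanish. -/
lemma eq_zero_of_sub_mul_log_nonpos {h : ℝ → ℝ} {a c : ℝ} (h0 : h 0 = 0)
    (hc : HasDerivAt h c 0) (hle : ∀ t, h t - a * (t * Real.log t) ≤ 0) : a = 0 ∧ c = 0 := by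
  have key : ∀ {h : ℝ → ℝ} {a c : ℝ}, h 0 = 0 → HasDerivAt h c 0 →
      (∀ t, h t - a * (t * Real.log t) ≤ 0) → a ≤ 0 := by
    intro h a c h0 hc hle
    by_contra! ha
    have h1 : Tendsto (fun t => t⁻¹ * h t) (𝓝[>] 0) (𝓝 c) := by
      have := (hasDerivAt_iff_tendsto_slope_zero.1 hc).mono_left
        (nhdsWithin_mono 0 (fun t (ht : t ∈ Set.Ioi 0) => ne_of_gt ht))
      simpa [h0] using this
    have h2 : Tendsto (fun t => a * Real.log t) (𝓝[>] 0) atBot :=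
      Real.tendsto_log_nhdsGT_zero.const_mul_atBot ha
    have h3 : ∀ᶠ t in 𝓝[>] (0 : ℝ), t⁻¹ * h t ≤ a * Real.log t := by
      filter_upwards [self_mem_nhdsWithin] with t (ht : 0 < t)
      rw [inv_mul_le_iff₀ ht]
      linarith [hle t]
    exact not_tendsto_nhds_of_tendsto_atBot (tendsto_atBot_mono' _ h3 h2) c h1
  have ha : a = 0 := by
    refine le_antisymm (key h0 hc hle) ?_
    have hneg : HasDerivAt (fun t => h (-t)) (-c) 0 := by
      have := HasDerivAt.scomp (x := (0 : ℝ)) (h := fun t : ℝ => -t) (h' := -1) (g₁ := h)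
        (g₁' := c) (by simpa using hc) (by simpa using hasDerivAt_neg (0 : ℝ))
      simpa [Function.comp_def] using this
    have := key (a := -a) (by simpa using h0) hneg fun t => by
      have := hle (-t)
      rw [Real.log_neg_eq_log] at this
      linarith
    linarith
  subst ha
  refine ⟨rfl, IsLocalMax.hasDerivAt_eq_zero ?_ hc⟩
  exact Eventually.of_forall fun t => by simpa [h0] using hle t

end

/-! ### Tangential angle structures, normal surfaces and the Neumann-Zagier form -/

instance (j : Fin 3) (s : TetEdge) : Decidable (QuadDisjoint j s) :=
  inferInstanceAs (Decidable (∀ v ∈ s.1, partner j v ∈ s.1))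

/-- The permutation of the edges of a tetrahedron induced by a permutation of its vertices. -/
def TetEdge.mapEquiv (g : Equiv.Perm (Fin 4)) : Equiv.Perm TetEdge where
  toFun := TetEdge.map g
  invFun := TetEdge.map g⁻¹
  left_inv s := Subtype.ext (by ext; simp [TetEdge.map, Equiv.Perm.inv_def])
  right_inv s := Subtype.ext (by ext; simp [TetEdge.map, Equiv.Perm.inv_def])

lemma TetEdge.sum_map {A : Type*} [AddCommMonoid A] (g : Equiv.Perm (Fin 4)) (f : TetEdge → A) :
    ∑ s : TetEdge, f (s.map g) = ∑ s, f s :=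
  Equiv.sum_comp (TetEdge.mapEquiv g) f

lemma TetEdge.apply_mem_map (g : Equiv.Perm (Fin 4)) (s : TetEdge) (i : Fin 4) :
    g i ∈ (TetEdge.map g s).1 ↔ i ∈ s.1 := by
  simp [TetEdge.map]

/-- In a tetrahedron of orientation sign `1`, the value of the Neumann-Zagier form on the
quadrilaterals disjoint from the edges `s` and `s'`. -/
def edgeForm (s s' : TetEdge) : ℤ :=
  ∑ j : Fin 3, ∑ j' : Fin 3, if QuadDisjoint j s ∧ QuadDisjoint j' s' then
    (if j' = j + 1 then 1 else if j = j' + 1 then -1 else 0) else 0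

lemma edgeForm_map (g : Equiv.Perm (Fin 4)) (s s' : TetEdge) :
    edgeForm (s.map g) (s'.map g) = Equiv.Perm.sign g * edgeForm s s' := by
  revert g s s'
  decide +kernel

/-- Edges that are distinct and not opposite lie in exactly one common face `i`; for equal or
opposite edges the form vanishes. -/
lemma edgeForm_eq_sum_faces (s s' : TetEdge) :
    edgeForm s s' = ∑ i : Fin 4, if i ∉ s.1 ∧ i ∉ s'.1 then edgeForm s s' else 0 := by
  revert s s'
  decide +kernel

lemma quadDisjoint_sub_mem {j : Fin 3} {v i : Fin 4} (h : partner j v = i) (s : TetEdge) :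
    ((if QuadDisjoint j s then 1 else 0) - (if v ∈ s.1 then 1 else 0) : ℤ) =
      if i ∉ s.1 then (if v ∈ s.1 then -1 else 1) else 0 := by
  revert j v i s
  decide +kernel

namespace Triangulation

variable {T : Type*} (M : Triangulation T)

lemma mkEdge_glue {σ : T} {i : Fin 4} {s : TetEdge} (h : i ∉ s.1) :
    M.mkEdge (M.glueTet σ i) (s.map (M.gluePerm σ i)) = M.mkEdge σ s :=
  (Quot.sound ⟨i, h, rfl⟩).symm

open Classical in
lemma index_eq_sum (q : Quad T) (e : M.Edge) :
    M.index q e = ∑ s : TetEdge, if M.mkEdge q.1 s = e ∧ QuadDisjoint q.2 s then 1 else 0 := by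
  rw [index, Finset.card_filter]
  exact Finset.sum_congr rfl fun s _ => by congr

/-- The involution on pairs (tetrahedron, face) given by the face pairing. -/
def facePairing : Equiv.Perm (T × Fin 4) :=
  Function.Involutive.toPerm (fun x => (M.glueTet x.1 x.2, M.gluePerm x.1 x.2 x.2)) (by
    rintro ⟨σ, i⟩
    simp [M.glueTet_glueTet, M.gluePerm_gluePerm])

lemma facePairing_apply (σ : T) (i : Fin 4) :
    M.facePairing (σ, i) = (M.glueTet σ i, M.gluePerm σ i i) := rfl

variable [Fintype T]

lemma sum_index_mul (q : Quad T) (h : M.Edge → ℝ) :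
    ∑ e, (M.index q e : ℝ) * h e =
      ∑ s : TetEdge, if QuadDisjoint q.2 s then h (M.mkEdge q.1 s) else 0 := by
  classical
  simp only [index_eq_sum, Nat.cast_sum, Finset.sum_mul]
  rw [Finset.sum_comm]
  refine Finset.sum_congr rfl fun s _ => ?_
  by_cases hs : QuadDisjoint q.2 s <;> simp [hs]

/-- The functions on quadrilaterals spanned by the tetrahedra and the edges are quadrilateral
coordinates of solutions of Haken's equations: with
`t(σ, v) = -c(σ) - ∑ h(s)`, summed over the three edges `s` of `σ` at `v`, both sides of the
equation of the arc at `v` in a face equal `h` on the side of the face opposite to `v`, minus `h`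
on the two sides at `v`. -/
lemma isNormalSolution_of_tet_edge (c : T → ℝ) (h : M.Edge → ℝ) :
    M.IsNormalSolution
      (fun x => -c x.1 - ∑ s : TetEdge, if x.2 ∈ s.1 then h (M.mkEdge x.1 s) else 0)
      (fun q => c q.1 + ∑ e, (M.index q e : ℝ) * h e) := by
  -- Each side of the equation is a sum over the edges of the face only.
  have key : ∀ (σ : T) (i v : Fin 4) (j : Fin 3), partner j v = i →
      (-c σ - ∑ s : TetEdge, if v ∈ s.1 then h (M.mkEdge σ s) else 0) +
        (c σ + ∑ e, (M.index (σ, j) e : ℝ) * h e) =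
      ∑ s : TetEdge, if i ∉ s.1 then
        (if v ∈ s.1 then -h (M.mkEdge σ s) else h (M.mkEdge σ s)) else 0 := by
    intro σ i v j hj
    have hcancel : ∀ a b d : ℝ, (-a - b) + (a + d) = d - b := fun a b d => by ring
    rw [sum_index_mul, hcancel, ← Finset.sum_sub_distrib]
    refine Finset.sum_congr rfl fun s _ => ?_
    have := congrArg (fun n : ℤ => (n : ℝ) * h (M.mkEdge σ s)) (quadDisjoint_sub_mem hj s)
    push_cast at this
    simpa [sub_mul, ite_mul] using this
  intro σ i v _ j j' hj hj'
  dsimp only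
  rw [key σ i v j hj, key _ _ _ j' hj', ← TetEdge.sum_map (M.gluePerm σ i) fun s =>
    if M.gluePerm σ i i ∉ s.1 then _ else _]
  refine Finset.sum_congr rfl fun s _ => ?_
  simp only [TetEdge.apply_mem_map]
  by_cases hi : i ∈ s.1
  · simp [hi]
  · rw [M.mkEdge_glue hi]

/-- The tangential angle structures: the tangent space to the circle-valued angle structures. -/
def TAS : Submodule ℝ (Quad T → ℝ) where
  carrier := {x | (∀ σ, ∑ j : Fin 3, x (σ, j) = 0) ∧ ∀ e, ∑ q, (M.index q e : ℝ) * x q = 0}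
  zero_mem' := by simp
  add_mem' {x y} hx hy := by
    refine ⟨fun σ => ?_, fun e => ?_⟩
    · simp [Finset.sum_add_distrib, hx.1 σ, hy.1 σ]
    · simp [mul_add, Finset.sum_add_distrib, hx.2 e, hy.2 e]
  smul_mem' a x hx := by
    refine ⟨fun σ => ?_, fun e => ?_⟩
    · simp [← Finset.mul_sum, hx.1 σ]
    · simp [mul_left_comm _ a, ← Finset.mul_sum, hx.2 e]

/-- Functions orthogonal to the tangential angle structures are spanned by the tetrahedra and
the edges. -/
lemma exists_tet_edge_of_orthogonal {y : Quad T → ℝ}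
    (hy : ∀ x ∈ M.TAS, ∑ q, y q * x q = 0) :
    ∃ (c : T → ℝ) (h : M.Edge → ℝ), ∀ q, y q = c q.1 + ∑ e, (M.index q e : ℝ) * h e := by
  classical
  let L : T ⊕ M.Edge → (Quad T → ℝ) →ₗ[ℝ] ℝ := Sum.elim
    (fun σ => ∑ j : Fin 3, LinearMap.proj (σ, j))
    (fun e => ∑ q, (M.index q e : ℝ) • LinearMap.proj q)
  have hmem : (∑ q, y q • LinearMap.proj q : (Quad T → ℝ) →ₗ[ℝ] ℝ) ∈
      Submodule.span ℝ (Set.range L) := by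
    refine mem_span_of_iInf_ker_le_ker fun x hx => ?_
    rw [Submodule.mem_iInf] at hx
    have : x ∈ M.TAS :=
      ⟨fun σ => by simpa [L] using hx (Sum.inl σ), fun e => by simpa [L] using hx (Sum.inr e)⟩
    simpa using hy x this
  obtain ⟨a, ha⟩ := (Submodule.mem_span_range_iff_exists_fun ℝ).1 hmem
  refine ⟨fun σ => a (Sum.inl σ), fun e => a (Sum.inr e), fun q => ?_⟩
  have hq := LinearMap.congr_fun ha (Pi.single q 1)
  have htet : ∀ σ, ∑ j : Fin 3, (Pi.single q 1 : Quad T → ℝ) (σ, j) = if σ = q.1 then 1 else 0 := by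
    intro σ
    by_cases hσ : σ = q.1
    · rw [if_pos hσ, Finset.sum_eq_single q.2]
      · simp [hσ]
      · intro j _ hj
        exact Pi.single_eq_of_ne (fun h => hj (congrArg Prod.snd h)) _
      · simp
    · rw [if_neg hσ]
      exact Finset.sum_eq_zero fun j _ => Pi.single_eq_of_ne (fun h => hσ (congrArg Prod.fst h)) _
  have hsingle : ∀ f : Quad T → ℝ, ∑ r, f r * (Pi.single q 1 : Quad T → ℝ) r = f q := fun f => by
    rw [Finset.sum_eq_single q (fun r _ hr => by rw [Pi.single_eq_of_ne hr, mul_zero]) (by simp),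
      Pi.single_eq_same, mul_one]
  simp only [L, Fintype.sum_sum_type, LinearMap.add_apply, LinearMap.coe_sum, Finset.sum_apply,
    LinearMap.smul_apply, Sum.elim_inl, Sum.elim_inr, LinearMap.proj_apply, smul_eq_mul, htet,
    hsingle, mul_ite, mul_one, mul_zero, Finset.sum_ite_eq', Finset.mem_univ, if_true] at hq
  rw [← hq]
  simp only [mul_comm]

end Triangulation

namespace OrientedTriangulation

variable {T : Type*} (M : OrientedTriangulation T)

lemma sum_omega_tet (q : Quad T) (σ : T) : ∑ j : Fin 3, M.omega q (σ, j) = 0 := by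
  obtain ⟨τ, j⟩ := q
  by_cases h : τ = σ
  · fin_cases j <;> simp [omega, h, Fin.sum_univ_three]
  · simp [omega, h]

variable [Fintype T]

/-- The edges are isotropic for the Neumann-Zagier form: the contribution of a tetrahedron is a
sum over its faces, and the contributions of two paired faces cancel. -/
lemma sum_index_mul_omega_mul_index (e e' : M.Edge) :
    ∑ q, ∑ r, (M.index q e : ℤ) * M.omega q r * M.index r e' = 0 := by
  classical
  let F : T × Fin 4 → ℤ := fun x => ∑ s : TetEdge, ∑ s' : TetEdge,
    if x.2 ∉ s.1 ∧ x.2 ∉ s'.1 then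
      (if M.mkEdge x.1 s = e ∧ M.mkEdge x.1 s' = e' then (M.orient x.1 : ℤ) * edgeForm s s' else 0)
    else 0
  have hF : ∀ x, F (M.facePairing x) = -F x := by
    rintro ⟨σ, i⟩
    simp only [F]
    simp only [← Finset.sum_neg_distrib]
    rw [← TetEdge.sum_map (M.gluePerm σ i)]
    refine Finset.sum_congr rfl fun s _ => ?_
    rw [← TetEdge.sum_map (M.gluePerm σ i)]
    refine Finset.sum_congr rfl fun s' _ => ?_
    simp only [Triangulation.facePairing_apply, TetEdge.apply_mem_map]
    by_cases hi : i ∉ s.1 ∧ i ∉ s'.1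
    · have ho : (M.orient (M.glueTet σ i) : ℤ) * (Equiv.Perm.sign (M.gluePerm σ i) : ℤ) =
          -(M.orient σ : ℤ) := by
        exact_mod_cast congrArg Units.val (M.orient_glue σ i)
      rw [if_pos hi, if_pos hi]
      simp only [M.mkEdge_glue hi.1, M.mkEdge_glue hi.2, edgeForm_map, ← mul_assoc, ho]
      split_ifs <;> simp
    · simp [hi]
  have hsum : ∑ x, F x = 0 := by
    have h1 := Equiv.sum_comp M.facePairing F
    simp only [hF, Finset.sum_neg_distrib] at h1
    omega
  have htet : ∀ σ, ∑ j, ∑ j', (M.index (σ, j) e : ℤ) * M.omega (σ, j) (σ, j') *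
      M.index (σ, j') e' = ∑ i, F (σ, i) := by
    intro σ
    have h1 : ∑ i, F (σ, i) = ∑ s : TetEdge, ∑ s' : TetEdge,
        if M.mkEdge σ s = e ∧ M.mkEdge σ s' = e' then (M.orient σ : ℤ) * edgeForm s s'
        else 0 := by
      simp only [F]
      rw [Finset.sum_comm]
      refine Finset.sum_congr rfl fun s _ => ?_
      rw [Finset.sum_comm]
      refine Finset.sum_congr rfl fun s' _ => ?_
      split_ifs with h
      · conv_rhs => rw [edgeForm_eq_sum_faces, Finset.mul_sum]
        simp [mul_ite]
      · simp
    have h2 : ∀ j j', (M.index (σ, j) e : ℤ) * M.omega (σ, j) (σ, j') * M.index (σ, j') e' =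
        ∑ s : TetEdge, ∑ s' : TetEdge, if M.mkEdge σ s = e ∧ M.mkEdge σ s' = e' then
          (M.orient σ : ℤ) * (if QuadDisjoint j s ∧ QuadDisjoint j' s' then
            (if j' = j + 1 then 1 else if j = j' + 1 then -1 else 0) else 0) else 0 := by
      intro j j'
      simp only [Triangulation.index_eq_sum, Nat.cast_sum, Finset.sum_mul, Finset.mul_sum]
      rw [Finset.sum_comm]
      refine Finset.sum_congr rfl fun s _ => Finset.sum_congr rfl fun s' _ => ?_
      simp only [omega, if_true]
      by_cases h1 : M.mkEdge σ s = e <;> by_cases h2 : M.mkEdge σ s' = e' <;>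
        by_cases h3 : QuadDisjoint j s <;> by_cases h4 : QuadDisjoint j' s' <;>
        simp [h1, h2, h3, h4]
    rw [h1]
    simp only [h2, edgeForm]
    calc _ = ∑ j : Fin 3, ∑ s : TetEdge, ∑ s' : TetEdge, ∑ j' : Fin 3, _ :=
          Finset.sum_congr rfl fun j _ => Finset.sum_comm.trans
            (Finset.sum_congr rfl fun s _ => Finset.sum_comm)
      _ = ∑ s : TetEdge, ∑ s' : TetEdge, ∑ j : Fin 3, ∑ j' : Fin 3, _ :=
          Finset.sum_comm.trans (Finset.sum_congr rfl fun s _ => Finset.sum_comm)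
      _ = _ := by
          refine Finset.sum_congr rfl fun s _ => Finset.sum_congr rfl fun s' _ => ?_
          split_ifs
          · simp only [Finset.mul_sum]
          · simp
  have hloc : ∀ q : Quad T, ∑ r, (M.index q e : ℤ) * M.omega q r * M.index r e' =
      ∑ j', (M.index q e : ℤ) * M.omega q (q.1, j') * M.index (q.1, j') e' := by
    intro q
    rw [Fintype.sum_prod_type]
    refine Finset.sum_eq_single q.1 (fun τ _ hτ => ?_) (by simp)
    simp [omega, hτ.symm]
  simp only [hloc]
  rw [Fintype.sum_prod_type]
  simp only [htet]
  rw [← hsum, Fintype.sum_prod_type]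

lemma sum_index_mul_omega_mem_TAS (e : M.Edge) :
    (fun r => ∑ q, (M.index q e : ℝ) * M.omega q r) ∈ M.TAS := by
  refine ⟨fun σ => ?_, fun e' => ?_⟩
  · rw [Finset.sum_comm]
    refine Finset.sum_eq_zero fun q _ => ?_
    rw [← Finset.mul_sum]
    have : ((∑ j : Fin 3, M.omega q (σ, j) : ℤ) : ℝ) = 0 := by rw [sum_omega_tet, Int.cast_zero]
    push_cast at this
    rw [this, mul_zero]
  · have h := congrArg (Int.cast : ℤ → ℝ) (M.sum_index_mul_omega_mul_index e e')
    push_cast at h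
    rw [Finset.sum_comm] at h
    rw [← h]
    refine Finset.sum_congr rfl fun r _ => ?_
    rw [Finset.mul_sum]
    exact Finset.sum_congr rfl fun q _ => by ring

end OrientedTriangulation

/-! ### Relations from non-differentiable terms -/

/-- If `∑ x(q) log |x(q)|` over `q ∈ U` is a linear function of `x ∈ S`, then every coordinate in
`U` occurs in a relation satisfied by `S` that involves at most one further coordinate. Otherwise
there is a line in `S` at one point of which `x(q₀)` changes sign, while no other coordinate
vanishes there except those that vanish on all of `S`. At this point, the term of `q₀` would be the
only one that is not differentiable. -/
lemma exists_relation_of_sum_mul_log_eq_zero {ι : Type*} [Fintype ι] (S : Submodule ℝ (ι → ℝ))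
    (U : Finset ι) (c : ι → ℝ)
    (h : ∀ x ∈ S, ∑ q ∈ U, x q * Real.log (x q) + ∑ q, c q * x q = 0) {q₀ : ι} (hq₀ : q₀ ∈ U) :
    ∃ y : ι → ℝ, y q₀ ≠ 0 ∧ {q | y q ≠ 0}.ncard ≤ 2 ∧ ∀ x ∈ S, ∑ q, y q * x q = 0 := by
  classical
  by_contra! hno
  obtain ⟨w, hw, hw0⟩ : ∃ w ∈ S, w q₀ ≠ 0 := by
    obtain ⟨x, hx, hx0⟩ := hno (Pi.single q₀ 1) (by simp) (by
      refine (Set.ncard_le_ncard (t := {q₀}) ?_).trans (by simp)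
      intro q hq
      by_contra hne
      exact hq (by simp [show q ≠ q₀ from hne]))
    exact ⟨x, hx, by simpa [Pi.single_apply] using hx0⟩
  have hdich : ∀ q₁, q₁ ≠ q₀ → (∃ z ∈ S, z q₁ ≠ 0) → ∃ x ∈ S, x q₀ = 0 ∧ x q₁ ≠ 0 := by
    rintro q₁ hne ⟨z, hz, hz1⟩
    by_cases h1 : w q₁ = 0
    · refine ⟨z - (z q₀ / w q₀) • w, S.sub_mem hz (S.smul_mem _ hw), ?_, ?_⟩
      · simp [hw0]
      · simpa [h1] using hz1
    · obtain ⟨x, hx, hx0⟩ := hno (Pi.single q₀ (w q₁) - Pi.single q₁ (w q₀))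
        (by simp [h1, hne.symm]) (by
          refine (Set.ncard_le_ncard (t := {q₀, q₁}) ?_).trans
            ((Set.ncard_insert_le _ _).trans (by simp))
          intro q hq
          by_contra hne
          simp only [Set.mem_insert_iff, Set.mem_singleton_iff, not_or] at hne
          exact hq (by simp [hne.1, hne.2]))
      refine ⟨x - (x q₀ / w q₀) • w, S.sub_mem hx (S.smul_mem _ hw), by simp [hw0], ?_⟩
      simp only [Pi.sub_apply, sub_mul, Finset.sum_sub_distrib, Pi.single_apply, ite_mul,
        zero_mul, Finset.sum_ite_eq', Finset.mem_univ, if_true] at hx0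
      simp only [Pi.sub_apply, Pi.smul_apply, smul_eq_mul]
      intro h2
      apply hx0
      field_simp at h2
      linarith
  -- A point of the hyperplane `x q₀ = 0` of `S` which is generic for all other coordinates.
  obtain ⟨x, ⟨hxS, hx0⟩, hx⟩ := Module.Dual.exists_forall_mem_ne_zero_of_forall_exists
    (ι := {q // q ≠ q₀ ∧ ∃ z ∈ S, z q ≠ 0})
    (S ⊓ LinearMap.ker (LinearMap.proj q₀ : (ι → ℝ) →ₗ[ℝ] ℝ)) (fun q => LinearMap.proj q.1)
    (fun q => by
      obtain ⟨x, hx, h0, h1⟩ := hdich q.1 q.2.1 q.2.2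
      exact ⟨x, ⟨hx, by simpa using h0⟩, by simpa using h1⟩)
  replace hx0 : x q₀ = 0 := by simpa using hx0
  have hline : ∀ s : ℝ, (s * w q₀) * Real.log (s * w q₀) =
      -(∑ q ∈ U.erase q₀, (x q + s * w q) * Real.log (x q + s * w q) +
        ∑ q, c q * (x q + s * w q)) := by
    intro s
    have := h (x + s • w) (S.add_mem hxS (S.smul_mem _ hw))
    rw [← Finset.add_sum_erase _ _ hq₀] at this
    simp only [Pi.add_apply, Pi.smul_apply, smul_eq_mul, hx0, zero_add] at this
    linarith
  have hdiff : DifferentiableAt ℝ (fun s : ℝ => (s * w q₀) * Real.log (s * w q₀)) 0 := by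
    simp_rw [hline]
    refine DifferentiableAt.neg (DifferentiableAt.add (DifferentiableAt.fun_sum fun q hq => ?_)
      (by fun_prop))
    by_cases hq' : ∃ z ∈ S, z q ≠ 0
    · have hxq : x q ≠ 0 := hx ⟨q, Finset.ne_of_mem_erase hq, hq'⟩
      have hlin : DifferentiableAt ℝ (fun s : ℝ => x q + s * w q) 0 := by fun_prop
      exact hlin.mul (hlin.log (by simpa using hxq))
    · push Not at hq'
      simp [hq' x hxS, hq' w hw]
  refine Real.not_DifferentiableAt_log_mul_zero ?_
  have : DifferentiableAt ℝ (fun s : ℝ => s * (w q₀)⁻¹) 0 := by fun_prop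
  have := DifferentiableAt.comp (0 : ℝ) (f := fun s : ℝ => s * (w q₀)⁻¹) (by simpa using hdiff) this
  refine this.congr_of_eventuallyEq (Filter.Eventually.of_forall fun s => ?_)
  simp [hw0]

/-! ### The first variation of the volume -/

/-- The quadrilaterals at which `p` is not smooth. -/
def flatQuads {T : Type*} [Fintype T] (p : Quad T → Circle) : Finset (Quad T) := by
  classical exact Finset.univ.filter fun q => p q = 1 ∨ p q = -1

lemma mem_flatQuads {T : Type*} [Fintype T] {p : Quad T → Circle} {q : Quad T} :
    q ∈ flatQuads p ↔ p q = 1 ∨ p q = -1 := by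
  simp [flatQuads]

lemma lobachevsky_arg_mul_exp (z : Circle) (u : ℝ) :
    lobachevsky (Complex.arg ((z * Circle.exp u : Circle) : ℂ)) =
      lobachevsky (Complex.arg (z : ℂ) + u) := by
  obtain ⟨n, hn⟩ := Circle.exp_eq_exp.1 (show
    Circle.exp (Complex.arg ((z * Circle.exp u : Circle) : ℂ)) =
      Circle.exp (Complex.arg (z : ℂ) + u) by
    rw [Circle.exp_arg, Circle.exp_add, Circle.exp_arg])
  have := lobachevsky_periodic.int_mul (n * 2) (Complex.arg (z : ℂ) + u)
  rw [hn, ← this]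
  push_cast
  ring_nf

lemma circle_exp_sum {ι : Type*} (s : Finset ι) (f : ι → ℝ) :
    Circle.exp (∑ i ∈ s, f i) = ∏ i ∈ s, Circle.exp (f i) :=
  map_sum Circle.expHom f s

lemma sin_arg_circle (z : Circle) : Real.sin (Complex.arg (z : ℂ)) = (z : ℂ).im := by
  rw [Complex.sin_arg, Circle.norm_coe, div_one]

lemma circle_im_eq_zero_iff (z : Circle) : (z : ℂ).im = 0 ↔ z = 1 ∨ z = -1 := by
  have h1 : (z : ℂ).re * (z : ℂ).re + (z : ℂ).im * (z : ℂ).im = 1 := by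
    rw [← Complex.normSq_apply, Circle.normSq_coe]
  constructor
  · intro h
    rw [h, mul_zero, add_zero, mul_self_eq_one_iff] at h1
    refine h1.imp (fun h1 => ?_) (fun h1 => ?_) <;> ext <;>
      apply Complex.ext <;> simp [h, h1]
  · rintro (h | h) <;> simp [h]

/-- The derivative of the summand of a quadrilateral in the volume along a line of angles, from
which the singular part `-(t b) log(t b)` has been removed if `z = ±1`. -/
lemma hasDerivAt_lobachevsky_arg_add (z : Circle) :
    ∃ c : ℝ, ((z : ℂ).im ≠ 0 → c = -Real.log |2 * (z : ℂ).im|) ∧ ∀ b : ℝ,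
      HasDerivAt (fun t : ℝ => lobachevsky (Complex.arg (z : ℂ) + t * b) +
        if (z : ℂ).im = 0 then (t * b) * Real.log (t * b) else 0) (c * b) 0 := by
  by_cases hz : (z : ℂ).im = 0
  · refine ⟨1 - Real.log 2, fun h => (h hz).elim, fun b => ?_⟩
    have hper : ∀ u, lobachevsky (Complex.arg (z : ℂ) + u) = lobachevsky u := by
      intro u
      rcases (circle_im_eq_zero_iff z).1 hz with h | h
      · simp [h]
      · simp [h, add_comm Real.pi, lobachevsky_add_pi]
    simp only [hz, if_true, hper]
    exact HasDerivAt.comp (0 : ℝ) (h₂ := fun u => lobachevsky u + u * Real.log u)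
      (h := fun t : ℝ => t * b) (by simpa using hasDerivAt_lobachevsky_add_mul_log)
      (by simpa using (hasDerivAt_id (0 : ℝ)).mul_const b)
  · refine ⟨-Real.log |2 * (z : ℂ).im|, fun _ => rfl, fun b => ?_⟩
    simp only [hz, if_false, add_zero]
    have h1 : HasDerivAt lobachevsky (-Real.log |2 * (z : ℂ).im|)
        (Complex.arg (z : ℂ) + 0 * b) := by
      rw [zero_mul, add_zero, ← sin_arg_circle]
      exact hasDerivAt_lobachevsky (by rwa [sin_arg_circle])
    exact HasDerivAt.comp (0 : ℝ) (h₂ := lobachevsky)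
      (h := fun t : ℝ => Complex.arg (z : ℂ) + t * b) h1
      (by simpa using ((hasDerivAt_id (0 : ℝ)).mul_const b).const_add (Complex.arg (z : ℂ)))

namespace Triangulation

variable {T : Type*} [Fintype T] (M : Triangulation T)

lemma mul_exp_mem_SAS {k : M.Edge → Circle} {p : Quad T → Circle} (hp : p ∈ M.SAS k)
    {x : Quad T → ℝ} (hx : x ∈ M.TAS) (t : ℝ) :
    (fun q => p q * Circle.exp (t * x q)) ∈ M.SAS k := by
  refine ⟨fun σ => ?_, fun e => ?_⟩
  · have h : ∏ j : Fin 3, Circle.exp (t * x (σ, j)) = 1 := by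
      rw [← circle_exp_sum, ← Finset.mul_sum, hx.1 σ]
      simp
    rw [Finset.prod_mul_distrib, hp.1 σ, h, mul_one]
  · have h : ∏ q, Circle.exp (t * x q) ^ M.index q e = 1 := by
      simp only [← Circle.exp_natCast_mul, ← circle_exp_sum]
      simp [mul_left_comm _ t, ← Finset.mul_sum, hx.2 e]
    simp only [mul_pow, Finset.prod_mul_distrib, hp.2 e, h, mul_one]

/-- The first variation of the volume at a maximum point. It is obtained from the vanishing of the
term of order `t`, after that of order `t log t`, in the volume along the curve of direction `x`;
the logarithms of the coordinates `x q` come from `(t x) log (t x) = x (t log t) + t (x log x)`. -/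
lemma exists_first_variation {k : M.Edge → Circle} {p : Quad T → Circle} (hp : p ∈ M.SAS k)
    (hmax : IsMaxOn volume (M.SAS k) p) :
    ∃ c : Quad T → ℝ, (∀ q, (p q : ℂ).im ≠ 0 → c q = Real.log |2 * (p q : ℂ).im|) ∧
      ∀ x ∈ M.TAS, ∑ q ∈ flatQuads p, x q * Real.log (x q) + ∑ q, c q * x q = 0 := by
  choose c hc hder using fun q => hasDerivAt_lobachevsky_arg_add (p q)
  refine ⟨fun q => -c q, fun q hq => neg_eq_iff_eq_neg.2 (hc q hq), fun x hx => ?_⟩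
  have hlog : ∀ t b : ℝ, (t * b) * Real.log (t * b) =
      b * (t * Real.log t) + t * (b * Real.log b) := by
    intro t b
    rcases eq_or_ne t 0 with rfl | ht
    · simp
    rcases eq_or_ne b 0 with rfl | hb
    · simp
    rw [Real.log_mul ht hb]
    ring
  have hflat : ∀ f : Quad T → ℝ,
      ∑ q, (if (p q : ℂ).im = 0 then f q else 0) = ∑ q ∈ flatQuads p, f q := by
    intro f
    rw [← Finset.sum_filter]
    refine Finset.sum_congr (Finset.ext fun q => ?_) fun _ _ => rfl
    simp [mem_flatQuads, circle_im_eq_zero_iff]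
  set B : ℝ := ∑ q ∈ flatQuads p, x q * Real.log (x q)
  let h : ℝ → ℝ := fun t => ∑ q, (lobachevsky (Complex.arg (p q : ℂ) + t * x q) +
    if (p q : ℂ).im = 0 then (t * x q) * Real.log (t * x q) else 0) - t * B - volume p
  have hh : HasDerivAt h (∑ q, c q * x q - 1 * B) 0 :=
    ((HasDerivAt.fun_sum fun q _ => hder q (x q)).sub
      ((hasDerivAt_id (0 : ℝ)).mul_const B)).sub_const _
  have h0 : h 0 = 0 := by simp [h, volume]
  have hle : ∀ t, h t - (∑ q ∈ flatQuads p, x q) * (t * Real.log t) ≤ 0 := by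
    intro t
    have hV := hmax (M.mul_exp_mem_SAS hp hx t)
    simp only [Set.mem_ofPred_eq, volume, lobachevsky_arg_mul_exp] at hV
    simp only [h, volume, Finset.sum_add_distrib, hflat, hlog, ← Finset.sum_mul,
      ← Finset.mul_sum]
    linarith
  have := (eq_zero_of_sub_mul_log_nonpos h0 hh hle).2
  simp only [neg_mul, Finset.sum_neg_distrib]
  linarith

end Triangulation

/-! ### Shapes at a smooth maximum point -/

/-- The shapes `z = (sin b / sin c) exp(i a)` at the angle `a` of the triangle with angles
`a`, `b`, `c`, and the shape at the angle `b`, satisfy Thurston's equation. The angles are given by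
points of the circle with product `-1`. -/
lemma shape_mul_one_sub_shape {a b c : Circle} (h : a * b * c = -1) (ha : (a : ℂ).im ≠ 0)
    (hc : (c : ℂ).im ≠ 0) :
    (((c : ℂ).im / (a : ℂ).im : ℝ) : ℂ) * (b : ℂ) *
      (1 - (((b : ℂ).im / (c : ℂ).im : ℝ) : ℂ) * (a : ℂ)) = 1 := by
  have hcim : (c : ℂ).im = (a : ℂ).re * (b : ℂ).im + (a : ℂ).im * (b : ℂ).re := by
    have hinv : (a : ℂ) * b = -(starRingEnd ℂ) c := by
      rw [← Circle.coe_inv_eq_conj, ← Circle.coe_mul, eq_mul_inv_of_mul_eq h, Circle.coe_mul]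
      simp
    have := congrArg Complex.im hinv
    rw [Complex.mul_im, Complex.neg_im, Complex.conj_im, neg_neg] at this
    exact this.symm
  have hb : (b : ℂ).re * (b : ℂ).re + (b : ℂ).im * (b : ℂ).im = 1 := by
    rw [← Complex.normSq_apply, Circle.normSq_coe]
  have key : (b : ℂ) * (((c : ℂ).im : ℂ) - ((b : ℂ).im : ℂ) * (a : ℂ)) = ((a : ℂ).im : ℂ) := by
    apply Complex.ext
    · simp only [Complex.mul_re, Complex.sub_re, Complex.sub_im, Complex.ofReal_re,
        Complex.ofReal_im, Complex.mul_im, hcim]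
      linear_combination (a : ℂ).im * hb
    · simp only [Complex.mul_re, Complex.sub_re, Complex.sub_im, Complex.ofReal_re,
        Complex.ofReal_im, Complex.mul_im, hcim]
      ring
  have ha' : ((a : ℂ).im : ℂ) ≠ 0 := Complex.ofReal_ne_zero.2 ha
  have hc' : ((c : ℂ).im : ℂ) ≠ 0 := Complex.ofReal_ne_zero.2 hc
  push_cast
  field_simp
  exact key

namespace OrientedTriangulation

variable {T : Type*} (M : OrientedTriangulation T)

/-- The quadrilateral that follows `q` in the cyclic order of the quadrilaterals of a
tetrahedron. -/
def nextQuad (q : Quad T) : Quad T := (q.1, if M.orient q.1 = 1 then q.2 + 1 else q.2 + 2)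

lemma nextQuad_nextQuad_nextQuad (q : Quad T) :
    M.nextQuad (M.nextQuad (M.nextQuad q)) = q := by
  obtain ⟨σ, j⟩ := q
  by_cases h : M.orient σ = 1 <;> fin_cases j <;> simp [nextQuad, h]

lemma omega_eq [DecidableEq T] (q r : Quad T) :
    M.omega q r = (if r = M.nextQuad q then 1 else 0) -
      (if r = M.nextQuad (M.nextQuad q) then 1 else 0) := by
  obtain ⟨σ, j⟩ := q
  obtain ⟨τ, l⟩ := r
  by_cases hσ : σ = τ
  · subst hσ
    rcases Int.units_eq_one_or (M.orient σ) with h | h <;> fin_cases j <;> fin_cases l <;>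
      simp [nextQuad, omega, h]
  · simp [nextQuad, omega, hσ, Ne.symm hσ]

lemma eq_nextQuad_of_omega {q r : Quad T} (h : M.omega q r = 1) : r = M.nextQuad q := by
  classical
  rw [omega_eq] at h
  by_contra hne
  rw [if_neg hne] at h
  split_ifs at h <;> omega

lemma mul_nextQuad_mul_nextQuad {p : Quad T → Circle} (h : ∀ σ, ∏ j : Fin 3, p (σ, j) = -1)
    (q : Quad T) : p q * p (M.nextQuad q) * p (M.nextQuad (M.nextQuad q)) = -1 := by
  obtain ⟨σ, j⟩ := q
  have h3 := h σ
  rw [Fin.prod_univ_three] at h3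
  have rotate : ∀ {a b c : Circle}, a * b * c = -1 → b * c * a = -1 := fun h => by
    rw [← h, mul_comm, mul_assoc]
  have swap : ∀ {a b c : Circle}, a * b * c = -1 → a * c * b = -1 := fun h => by
    rw [← h, mul_right_comm]
  by_cases ho : M.orient σ = 1 <;> fin_cases j <;> simp only [nextQuad, ho, if_true, if_false]
  · exact h3
  · exact rotate h3
  · exact rotate (rotate h3)
  · exact swap h3
  · exact rotate (rotate (swap h3))
  · exact rotate (swap h3)

variable [Fintype T]

/-- If the first variation `∑ c(q) x(q)` with `c(q) = log |2 sin arg p(q)|` vanishes on the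
tangential angle structures, the moduli of the shapes have product `1` around every edge: this is
its vanishing at the tangential angle structure dual to the edge. -/
lemma prod_im_div_im_pow_index {p : Quad T → Circle} (him : ∀ q, (p q : ℂ).im ≠ 0)
    (h : ∀ x ∈ M.TAS, ∑ q, Real.log |2 * (p q : ℂ).im| * x q = 0) (e : M.Edge) :
    ∏ q, ((p (M.nextQuad q) : ℂ).im / (p (M.nextQuad (M.nextQuad q)) : ℂ).im) ^
      (2 * M.index q e) = 1 := by
  classical
  set L : Quad T → ℝ := fun q => Real.log |2 * (p q : ℂ).im| with hL
  have hexp : ∀ q, Real.exp (L q) = |2 * (p q : ℂ).im| := fun q =>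
    Real.exp_log (abs_pos.2 (mul_ne_zero two_ne_zero (him q)))
  have hsum : ∑ q, (M.index q e : ℝ) * (L (M.nextQuad q) - L (M.nextQuad (M.nextQuad q))) = 0 := by
    rw [← h _ (M.sum_index_mul_omega_mem_TAS e)]
    simp only [Finset.mul_sum]
    rw [Finset.sum_comm]
    refine Finset.sum_congr rfl fun q _ => ?_
    simp only [mul_left_comm _ (M.index q e : ℝ), ← Finset.mul_sum]
    congr 1
    simp [omega_eq, mul_sub, Finset.sum_sub_distrib, hL]
  have hterm : ∀ q, ((p (M.nextQuad q) : ℂ).im / (p (M.nextQuad (M.nextQuad q)) : ℂ).im) ^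
      (2 * M.index q e) =
      Real.exp ((M.index q e : ℝ) * (L (M.nextQuad q) - L (M.nextQuad (M.nextQuad q)))) ^ 2 := by
    intro q
    rw [Real.exp_nat_mul, Real.exp_sub, hexp, hexp, ← abs_div,
      mul_div_mul_left _ _ two_ne_zero, pow_right_comm, sq_abs, pow_mul]
  simp only [hterm]
  rw [Finset.prod_pow, ← Real.exp_sum, hsum, Real.exp_zero, one_pow]

end OrientedTriangulation

end PseudoManifold

end

theorem theorem3p2 {T : Type*} [Fintype T] (M : PseudoManifold.OrientedTriangulation T)
    (k : M.Edge → Circle) (hk : M.IsAdmissible k)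
    (p : PseudoManifold.Quad T → Circle) (hp : p ∈ M.SAS k)
    (hmax : IsMaxOn PseudoManifold.volume (M.SAS k) p) :
    ((∀ q, p q ≠ 1 ∧ p q ≠ -1) →
      ∃ z : PseudoManifold.Quad T → ℂ, M.IsThurstonSolution k z ∧
        ∀ q, ∃ r : ℝ, z q = (r : ℂ) * (p q : ℂ)) ∧
    (∀ q₀, (p q₀ = 1 ∨ p q₀ = -1) →
      ∃ (t : PseudoManifold.Tri T → ℝ) (y : PseudoManifold.Quad T → ℝ),
        M.IsNormalSolution t y ∧ {q | y q ≠ 0}.ncard ≤ 2 ∧ y q₀ ≠ 0) := by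
  obtain ⟨c, hc, hvar⟩ := M.exists_first_variation hp hmax
  refine ⟨fun hsmooth => ?_, fun q₀ hq₀ => ?_⟩
  · have him : ∀ q, (p q : ℂ).im ≠ 0 := fun q h =>
      ((PseudoManifold.circle_im_eq_zero_iff (p q)).1 h).elim (hsmooth q).1 (hsmooth q).2
    have hflat : PseudoManifold.flatQuads p = ∅ := Finset.eq_empty_of_forall_notMem fun q hq =>
      (PseudoManifold.mem_flatQuads.1 hq).elim (hsmooth q).1 (hsmooth q).2
    simp only [hflat, Finset.sum_empty, zero_add, fun q => hc q (him q)] at hvar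
    refine ⟨fun q => (((p (M.nextQuad q) : ℂ).im /
      (p (M.nextQuad (M.nextQuad q)) : ℂ).im : ℝ) : ℂ) * p q, ⟨?_, fun e => ?_⟩,
      fun q => ⟨_, rfl⟩⟩
    · intro q q' hω
      obtain rfl := M.eq_nextQuad_of_omega hω
      dsimp only
      rw [M.nextQuad_nextQuad_nextQuad]
      exact PseudoManifold.shape_mul_one_sub_shape (M.mul_nextQuad_mul_nextQuad hp.1 q) (him _)
        (him _)
    · have h1 := congrArg (Complex.ofReal) (M.prod_im_div_im_pow_index him hvar e)
      rw [Complex.ofReal_prod, Complex.ofReal_one] at h1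
      have h2 : ∏ q, (p q : ℂ) ^ (2 * M.index q e) = (k e : ℂ) ^ 2 := by
        rw [← hp.2 e]
        simp only [mul_comm 2, pow_mul, Finset.prod_pow]
        congr 1
        exact (map_prod Circle.coeHom (fun q => p q ^ M.index q e) Finset.univ).symm
      simp only [mul_pow, Finset.prod_mul_distrib, h2, ← Complex.ofReal_pow, h1, one_mul]
  · obtain ⟨y, hy0, hcard, hy⟩ :=
      PseudoManifold.exists_relation_of_sum_mul_log_eq_zero M.TAS
        (PseudoManifold.flatQuads p) c hvar (PseudoManifold.mem_flatQuads.2 hq₀)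
    obtain ⟨a, b, hab⟩ := M.exists_tet_edge_of_orthogonal hy
    have hty := M.isNormalSolution_of_tet_edge a b
    rw [← funext hab] at hty
    exact ⟨_, y, hty, hcard, hy0⟩
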